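/- Let $(S,\mathfrak n)$ be a local ring (commutative, Noetherian, with unique maximal ideal $\mathfrak n$), let $f_1,\dots,f_r$ with $r\ge 1$ be a regular sequence of $S$, and put $R=S/(f_1,\dots,f_r)$. Let $M$ and $N$ be non-zero finitely generated $R$-modules. Assume that (1) $M$ has finite projective dimension as an $S$-module, (2) $M\otimes_R N$ has finite length, and (3) $\operatorname{depth}(M)+\operatorname{depth}(N)\ge\operatorname{depth}(S)$. Then $\operatorname{depth}(M)+\operatorname{depth}(N)=\operatorname{depth}(S)$, and for every integer $i\ge 0$ one has $\operatorname{Tor}^R_i(M,N)\ne 0$ if and only if $i$ is even. (Here the depth of a finitely generated module over a local ring is the supremum of the lengths of its regular sequences contained in the maximal ideal.) -/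

import Mathlib

universe u

/-- The depth of a module `M` over a local ring `R`: the supremum of the lengths of the `M`-regular
sequences contained in the maximal ideal. The depth of the zero module is `⊤`. -/
noncomputable def localDepth (R M : Type*) [CommRing R] [IsLocalRing R] [AddCommGroup M]
    [Module R M] : ℕ∞ :=
  open Classical in
  if Subsingleton M then ⊤
  else ⨆ rs : {rs : List R // (∀ x ∈ rs, x ∈ IsLocalRing.maximalIdeal R) ∧
    RingTheory.Sequence.IsRegular M rs}, (rs.1.length : ℕ∞)

/-- `Tor_i^R(M, N)`, as an `R`-module. -/
noncomputable abbrev torModule (R : Type u) [CommRing R] (i : ℕ) (M N : Type u)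
    [AddCommGroup M] [Module R M] [AddCommGroup N] [Module R N] : ModuleCat.{u} R :=
  ((CategoryTheory.Tor (ModuleCat.{u} R) i).obj (ModuleCat.of R M)).obj (ModuleCat.of R N)

/-! Write `M^∨` for the character module of `M`. For `i > 0`, `Tor_i^R(M, N)` vanishes exactly when
`Ext_R^i(N, M^∨)` does, so the work is done with `Ext` into `M^∨`, whose injective dimension over
`S` is at most `p = pd_S M` (`extVanishes_characterModule`).

As `M ⊗ N` has finite length, each element of the maximal ideal of `S` has a power in `Ann N + Ann
M^∨`. Depth sensitivity (`extVanishes_of_isWeaklyRegular`) then gives `Ext_S^i(N, M^∨) = 0` for `i >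
p - depth N`. Since `Hom(N, M^∨) = (N ⊗ M)^∨` is nonzero, `depth N ≤ p`. Together with `pd M + depth
M ≤ depth S`, the depth hypothesis forces `p = depth N` and equality of depths, so `Ext_S^i(N, M^∨)
= 0` for all `i > 0` (`depth_add_eq_and_extVanishes`).

The `f_j` are then divided out one at a time. For `B = A/(a)`, a presentation `0 → K → F → N → 0`
over `A` yields `0 → N → B ⊗ K → B ⊗ F → N → 0` over `B`. If the odd `Ext_A(N, I)` vanish, this
sequence propagates vanishing in odd degrees and, starting from `Hom(N, I) ≠ 0`, nonvanishing in
even degrees (`extVanishes_odd_and_not_even`). -/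

open CategoryTheory CategoryTheory.Abelian IsLocalRing TensorProduct

/-! ### Vanishing of `Ext` in short exact sequences, and depth sensitivity. -/

section ExtVanishing

variable (A : Type u) [CommRing A]

/-- The vanishing of `Ext_A^i(X, Y)`. -/
abbrev ExtVanishes (i : ℕ) (X Y : Type u) [AddCommGroup X] [Module A X] [AddCommGroup Y]
    [Module A Y] : Prop :=
  Subsingleton (Ext.{u} (ModuleCat.of A X) (ModuleCat.of A Y) i)

variable {A} {X Y Z I : Type u} [AddCommGroup X] [Module A X] [AddCommGroup Y] [Module A Y]
  [AddCommGroup Z] [Module A Z] [AddCommGroup I] [Module A I] {f : X →ₗ[A] Y} {g : Y →ₗ[A] Z}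

lemma moduleCatMk_shortExact (hf : Function.Injective f) (hfg : Function.Exact f g)
    (hg : Function.Surjective g) :
    (ShortComplex.moduleCatMk f g hfg.linearMap_comp_eq_zero).ShortExact :=
  ModuleCat.shortComplex_shortExact _ hfg hf hg

lemma extVanishes_zero_iff : ExtVanishes A 0 X I ↔ Subsingleton (X →ₗ[A] I) := by
  rw [ExtVanishes, Ext.addEquiv₀.subsingleton_congr]
  exact ModuleCat.homAddEquiv.subsingleton_congr

lemma extVanishes_of_projective [Module.Projective A X] (i : ℕ) : ExtVanishes A (i + 1) X I :=
  have : Projective (ModuleCat.of A X) := (IsProjective.iff_projective X).mp inferInstance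
  Ext.subsingleton_of_projective _ _ i

section Contravariant

variable (hf : Function.Injective f) (hfg : Function.Exact f g) (hg : Function.Surjective g)

include hf hfg hg

/-- Here `left`/`right` names the argument of `Ext` in which the sequence varies, and the index the
term whose vanishing is concluded. -/
lemma extVanishes_left₁ {i : ℕ} (hY : ExtVanishes A i Y I) (hZ : ExtVanishes A (i + 1) Z I) :
    ExtVanishes A i X I := by
  refine subsingleton_of_forall_eq 0 fun x ↦ ?_
  obtain ⟨y, rfl⟩ := Ext.contravariant_sequence_exact₁ (moduleCatMk_shortExact hf hfg hg) _ x
    (add_comm 1 i) (hZ.elim _ _)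
  rw [(hY.elim _ _ : y = 0), Ext.comp_zero]
  rfl

lemma extVanishes_left₃ {i : ℕ} (hX : ExtVanishes A i X I) (hY : ExtVanishes A (i + 1) Y I) :
    ExtVanishes A (i + 1) Z I := by
  refine subsingleton_of_forall_eq 0 fun z ↦ ?_
  obtain ⟨x, rfl⟩ := Ext.contravariant_sequence_exact₃ (moduleCatMk_shortExact hf hfg hg) _ z
    (hY.elim _ _) (add_comm 1 i)
  rw [(hX.elim _ _ : x = 0), Ext.comp_zero]
  rfl

lemma exists_extend_of_extVanishes_one (hZ : ExtVanishes A 1 Z I) (φ : X →ₗ[A] I) :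
    ∃ Φ : Y →ₗ[A] I, Φ ∘ₗ f = φ := by
  obtain ⟨y, hy⟩ := Ext.contravariant_sequence_exact₁ (moduleCatMk_shortExact hf hfg hg) _
    (Ext.mk₀ (ModuleCat.ofHom φ)) (add_comm 1 0) (hZ.elim _ _)
  obtain ⟨y, rfl⟩ := (Ext.mk₀_bijective _ _).2 y
  rw [Ext.mk₀_comp_mk₀] at hy
  exact ⟨y.hom, congr(ModuleCat.Hom.hom $((Ext.mk₀_bijective _ _).1 hy))⟩

lemma extVanishes_one_of_exists_extend (hY : ExtVanishes A 1 Y I)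
    (h : ∀ φ : X →ₗ[A] I, ∃ Φ : Y →ₗ[A] I, Φ ∘ₗ f = φ) : ExtVanishes A 1 Z I := by
  refine subsingleton_of_forall_eq 0 fun z ↦ ?_
  have hS := moduleCatMk_shortExact hf hfg hg
  obtain ⟨x, rfl⟩ := Ext.contravariant_sequence_exact₃ hS _ z (hY.elim _ _) (add_comm 1 0)
  obtain ⟨x, rfl⟩ := (Ext.mk₀_bijective _ _).2 x
  obtain ⟨Ψ, rfl⟩ : ∃ Ψ, (ShortComplex.moduleCatMk f g hfg.linearMap_comp_eq_zero).f ≫ Ψ = x :=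
    have ⟨Φ, hΦ⟩ := h x.hom
    ⟨ModuleCat.ofHom Φ, ModuleCat.hom_ext hΦ⟩
  rw [← Ext.mk₀_comp_mk₀, ShortComplex.ShortExact.extClass_comp_assoc]
  rfl

end Contravariant

section Covariant

variable (hf : Function.Injective f) (hfg : Function.Exact f g) (hg : Function.Surjective g)

include hf hfg hg

lemma extVanishes_right₁ {i : ℕ} (hZ : ExtVanishes A i I Z) (hY : ExtVanishes A (i + 1) I Y) :
    ExtVanishes A (i + 1) I X := by
  refine subsingleton_of_forall_eq 0 fun x ↦ ?_
  obtain ⟨z, rfl⟩ := Ext.covariant_sequence_exact₁ _ (moduleCatMk_shortExact hf hfg hg) x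
    (hY.elim _ _) rfl
  rw [(hZ.elim _ _ : z = 0), Ext.zero_comp]
  rfl

lemma extVanishes_right₃ {i : ℕ} (hY : ExtVanishes A i I Y) (hX : ExtVanishes A (i + 1) I X) :
    ExtVanishes A i I Z := by
  refine subsingleton_of_forall_eq 0 fun z ↦ ?_
  obtain ⟨y, rfl⟩ := Ext.covariant_sequence_exact₃ _ (moduleCatMk_shortExact hf hfg hg) z
    rfl (hX.elim _ _)
  rw [(hY.elim _ _ : y = 0), Ext.zero_comp]
  rfl

end Covariant

/-- An element which is a sum of an annihilator of `X` and an annihilator of `I` kills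
`Ext(X, I)`. -/
lemma ext_smul_eq_zero {a : A} (ha : a ∈ Module.annihilator A X ⊔ Module.annihilator A I) {i : ℕ}
    (e : Ext.{u} (ModuleCat.of A X) (ModuleCat.of A I) i) : a • e = 0 := by
  obtain ⟨b, hb, c, hc, rfl⟩ := Submodule.mem_sup.mp ha
  have hb' : b • 𝟙 (ModuleCat.of A X) = 0 := by
    ext x
    exact Module.mem_annihilator.mp hb x
  have hc' : c • 𝟙 (ModuleCat.of A I) = 0 := by
    ext x
    exact Module.mem_annihilator.mp hc x
  have h1 : b • e = 0 := by
    rw [← Ext.mk₀_id_comp (b • e), Ext.comp_smul, ← Ext.smul_comp, ← Ext.mk₀_smul, hb',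
      Ext.mk₀_zero, Ext.zero_comp]
  have h2 : c • e = 0 := by
    rw [Ext.smul_eq_comp_mk₀, hc', Ext.mk₀_zero, Ext.comp_zero]
  rw [add_smul, h1, h2, add_zero]

/-- If `x` is regular on `X` and a power of `x` kills `Ext^i(X, I)`, then the latter vanishes as
soon as `Ext^{i+1}(X/xX, I)` does. -/
lemma extVanishes_of_quotSMulTop {x : A} (hx : IsSMulRegular X x) {k : ℕ}
    (hk : x ^ k ∈ Module.annihilator A X ⊔ Module.annihilator A I) {i : ℕ}
    (h : ExtVanishes A (i + 1) (QuotSMulTop x X) I) : ExtVanishes A i X I := by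
  refine subsingleton_of_forall_eq 0 fun e ↦ ?_
  -- The cokernel of `x` on `Ext^i(X, I)` embeds in `Ext^{i+1}(X/xX, I) = 0`, so every class is
  -- divisible by `x`, hence by `x ^ k`, which acts as zero.
  have hdiv (e : Ext.{u} (ModuleCat.of A X) (ModuleCat.of A I) i) :
      ∃ e' : Ext.{u} (ModuleCat.of A X) (ModuleCat.of A I) i, x • e' = e := by
    obtain ⟨e', rfl⟩ : ∃ e' : Ext.{u} (ModuleCat.of A X) (ModuleCat.of A I) i,
        (Ext.mk₀ (x • 𝟙 (ModuleCat.of A X))).comp e' (zero_add i) = e :=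
      Ext.contravariant_sequence_exact₁
        (IsSMulRegular.smulShortComplex_shortExact (M := ModuleCat.of A X) hx) _ e (add_comm 1 i)
        (h.elim _ _)
    exact ⟨e', by rw [Ext.mk₀_smul, Ext.smul_comp, Ext.mk₀_id_comp]⟩
  have hpow (n : ℕ) : ∃ e' : Ext.{u} (ModuleCat.of A X) (ModuleCat.of A I) i, x ^ n • e' = e := by
    induction n with
    | zero => exact ⟨e, by simp⟩
    | succ n ih =>
      obtain ⟨e', rfl⟩ := ih
      obtain ⟨e'', rfl⟩ := hdiv e'
      exact ⟨e'', by rw [pow_succ, mul_smul]⟩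
  obtain ⟨e', rfl⟩ := hpow k
  exact ext_smul_eq_zero hk e'

lemma annihilator_le_annihilator_quotSMulTop (x : A) :
    Module.annihilator A X ≤ Module.annihilator A (QuotSMulTop x X) :=
  LinearMap.annihilator_le_of_surjective _ (Submodule.mkQ_surjective _)

open RingTheory.Sequence in
/-- Depth sensitivity: if every element of `xs` has a power in `Ann X + Ann I`, and `xs` is
`X`-regular, then the vanishing range of `Ext(-, I)` improves by the length of `xs`. -/
lemma extVanishes_of_isWeaklyRegular {p : ℕ}
    (hI : ∀ (i : ℕ), p < i → ∀ (W : Type u) [AddCommGroup W] [Module A W], ExtVanishes A i W I)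
    (xs : List A) (hreg : IsWeaklyRegular X xs)
    (hpow : ∀ x ∈ xs, ∃ k, x ^ k ∈ Module.annihilator A X ⊔ Module.annihilator A I)
    (i : ℕ) (hi : p < i + xs.length) : ExtVanishes A i X I := by
  induction xs generalizing X i with
  | nil => exact hI i hi X
  | cons x xs ih =>
    rw [isWeaklyRegular_cons_iff] at hreg
    obtain ⟨k, hk⟩ := hpow x (by simp)
    refine extVanishes_of_quotSMulTop hreg.1 hk (ih hreg.2 (fun y hy ↦ ?_) _ ?_)
    · obtain ⟨l, hl⟩ := hpow y (by simp [hy])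
      exact ⟨l, sup_le_sup_right (annihilator_le_annihilator_quotSMulTop x) _ hl⟩
    · simp only [List.length_cons] at hi
      lia

end ExtVanishing

lemma exists_projective_presentation (A X : Type u) [CommRing A] [AddCommGroup X] [Module A X] :
    ∃ (K F : Type u) (_ : AddCommGroup K) (_ : Module A K) (_ : AddCommGroup F) (_ : Module A F)
      (_ : Module.Projective A F) (f : K →ₗ[A] F) (g : F →ₗ[A] X),
      Function.Injective f ∧ Function.Exact f g ∧ Function.Surjective g :=
  ⟨(Finsupp.linearCombination A (id : X → X)).ker, X →₀ A, inferInstance, inferInstance,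
    inferInstance, inferInstance, inferInstance,
    (Finsupp.linearCombination A (id : X → X)).ker.subtype, Finsupp.linearCombination A id,
    (Finsupp.linearCombination A (id : X → X)).ker.injective_subtype,
    (Finsupp.linearCombination A (id : X → X)).exact_subtype_ker_map,
    Finsupp.linearCombination_id_surjective A X⟩

/-! ### Two-periodicity from a four-term exact sequence. -/

section Periodicity

/-- A four-term exact sequence `0 → N → K → G → N → 0` with `G` projective makes the vanishing of
`Ext(N, I)` periodic. -/
lemma extVanishes_of_two_periodic {B N I K L G : Type u} [CommRing B] [AddCommGroup N] [Module B N]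
    [AddCommGroup I] [Module B I] [AddCommGroup K] [Module B K] [AddCommGroup L] [Module B L]
    [AddCommGroup G] [Module B G] [Module.Projective B G]
    {v : N →ₗ[B] K} {w : K →ₗ[B] L} {j : L →ₗ[B] G} {p : G →ₗ[B] N}
    (hv : Function.Injective v) (hvw : Function.Exact v w) (hw : Function.Surjective w)
    (hj : Function.Injective j) (hjp : Function.Exact j p) (hp : Function.Surjective p)
    (hK : ∀ i, ExtVanishes B (2 * i + 2) K I)
    (hext : ∀ φ : L →ₗ[B] I, ∃ Φ : G →ₗ[B] I, Φ ∘ₗ j = φ)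
    (hzero : ∀ Φ : K →ₗ[B] I, Φ ∘ₗ v = 0) :
    (∀ i, ExtVanishes B (2 * i + 1) N I) ∧
      (Nontrivial (N →ₗ[B] I) → ∀ i, ¬ ExtVanishes B (2 * i) N I) := by
  refine ⟨fun i ↦ ?_, fun hnt i ↦ ?_⟩
  · induction i with
    | zero => exact extVanishes_one_of_exists_extend hj hjp hp (extVanishes_of_projective 0) hext
    | succ i ih =>
      -- `Ext^{2i+1}(N)` and `Ext^{2i+2}(K)` bracket `Ext^{2i+2}(L)`, which surjects onto
      -- `Ext^{2i+3}(N)`.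
      exact extVanishes_left₃ hj hjp hp (extVanishes_left₃ hv hvw hw ih (hK i))
        (extVanishes_of_projective _)
  · induction i with
    | zero => rwa [extVanishes_zero_iff, not_subsingleton_iff_nontrivial]
    | succ i ih =>
      intro h2
      have hL : ExtVanishes B (2 * i + 1) L I :=
        extVanishes_left₁ hj hjp hp (extVanishes_of_projective _) h2
      cases i with
      | zero =>
        -- `Ext^1(L, I) = 0` would make the restriction `Hom(K, I) → Hom(N, I)` surjective, yet it
        -- is zero.
        refine not_subsingleton _ (subsingleton_of_forall_eq (0 : N →ₗ[B] I) fun φ ↦ ?_)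
        obtain ⟨Φ, rfl⟩ := exists_extend_of_extVanishes_one hv hvw hw hL φ
        exact hzero Φ
      | succ i => exact ih (extVanishes_left₁ hv hvw hw (hK i) hL)

end Periodicity

/-! ### Passing from `A` to `B = A/(a)`. -/

section ChangeOfRings

variable {A B : Type u} [CommRing A] [CommRing B] [Algebra A B] {a : A}

lemma isSMulRegular_of_flat {X : Type*} [AddCommGroup X] [Module A X] [Module.Flat A X]
    (h : IsSMulRegular A a) : IsSMulRegular X a :=
  Module.Flat.isSMulRegular_of_nonZeroDivisors
    (mem_nonZeroDivisors_iff.mpr ⟨fun x hx ↦ h (by simpa using hx),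
      fun x hx ↦ h (by simpa [mul_comm] using hx)⟩)

lemma isSMulRegular_of_injective_of_flat {X Y : Type*} [AddCommGroup X] [Module A X]
    [AddCommGroup Y] [Module A Y] [Module.Flat A Y] {f : X →ₗ[A] Y} (hf : Function.Injective f)
    (h : IsSMulRegular A a) : IsSMulRegular X a := fun x y hxy ↦
  hf (isSMulRegular_of_flat h (by simpa using congr(f $hxy)))

variable (hsurj : Function.Surjective (algebraMap A B))
  (hker : RingHom.ker (algebraMap A B) = Ideal.span {a})

include hker in
lemma algebraMap_eq_zero_of_ker : algebraMap A B a = 0 := by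
  rw [← RingHom.mem_ker, hker]
  exact Ideal.mem_span_singleton_self a

include hker in
lemma smul_eq_zero_of_ker {X : Type*} [AddCommGroup X] [Module A X] [Module B X]
    [IsScalarTower A B X] (x : X) : a • x = 0 := by
  rw [← algebraMap_smul B a x, algebraMap_eq_zero_of_ker hker, zero_smul]

include hsurj hker in
-- This is `B ⊗ X = X/aX`; it lets the `Tor` arguments below be done on elements.
lemma one_tmul_eq_zero_iff {X : Type*} [AddCommGroup X] [Module A X] (x : X) :
    (1 : B) ⊗ₜ[A] x = 0 ↔ ∃ y : X, a • y = x := by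
  have hex : Function.Exact (LinearMap.lsmul A A a) (Algebra.linearMap A B) := by
    intro b
    rw [Algebra.linearMap_apply, ← RingHom.mem_ker, hker, Ideal.mem_span_singleton]
    exact ⟨fun ⟨c, hc⟩ ↦ ⟨c, hc.symm⟩, fun ⟨c, hc⟩ ↦ ⟨c, hc.symm⟩⟩
  have := rTensor_exact X hex hsurj ((1 : A) ⊗ₜ x)
  rw [LinearMap.rTensor_tmul, Algebra.linearMap_apply, map_one] at this
  rw [this]
  constructor
  · rintro ⟨z, hz⟩
    refine ⟨TensorProduct.lid A X z, ?_⟩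
    have h2 (z : A ⊗[A] X) : TensorProduct.lid A X ((LinearMap.lsmul A A a).rTensor X z) =
        a • TensorProduct.lid A X z := by
      induction z with
      | zero => simp
      | add z w hz hw => simp_all
      | tmul r y => simp [mul_smul]
    rw [← h2, hz, TensorProduct.lid_tmul, one_smul]
  · rintro ⟨y, rfl⟩
    exact ⟨1 ⊗ₜ y, by simp [TensorProduct.smul_tmul']⟩

section

variable {X Y Z I : Type u} [AddCommGroup X] [Module A X] [AddCommGroup Y] [Module A Y]
  [AddCommGroup Z] [Module A Z] {f : X →ₗ[A] Y} {g : Y →ₗ[A] Z}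

include hsurj hker in
-- The obstruction `Tor_1^A(B, Z)` is the `a`-torsion of `Z`.
lemma baseChange_injective_of_isSMulRegular (hf : Function.Injective f)
    (hfg : Function.Exact f g) (hZ : IsSMulRegular Z a) :
    Function.Injective (f.baseChange B) := by
  rw [injective_iff_map_eq_zero]
  intro z hz
  obtain ⟨x, rfl⟩ := TensorProduct.mk_surjective A X B hsurj z
  rw [TensorProduct.mk_apply, LinearMap.baseChange_tmul, one_tmul_eq_zero_iff hsurj hker] at hz
  obtain ⟨y, hy⟩ := hz
  have hgy : g y = 0 := hZ (by simp [← map_smul, hy, hfg.apply_apply_eq_zero])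
  obtain ⟨x', rfl⟩ := (hfg y).mp hgy
  rw [← map_smul] at hy
  rw [TensorProduct.mk_apply, one_tmul_eq_zero_iff hsurj hker]
  exact ⟨x', hf hy⟩

include hsurj hker in
-- `B`-linear maps `B ⊗ X → I` are `A`-linear maps `X → I`, so an extension to `Y` over `A` is one
-- to `B ⊗ Y` over `B`.
lemma extVanishes_one_baseChange [Module.Projective A Y] (hf : Function.Injective f)
    (hfg : Function.Exact f g) (hg : Function.Surjective g) [AddCommGroup I] [Module A I]
    [Module B I] [IsScalarTower A B I] (hZ : IsSMulRegular Z a) (h : ExtVanishes A 1 Z I) :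
    ExtVanishes B 1 (B ⊗[A] Z) I := by
  have hfgB : Function.Exact (f.baseChange B) (g.baseChange B) := lTensor_exact B hfg hg
  have hgB : Function.Surjective (g.baseChange B) := LinearMap.lTensor_surjective B hg
  refine extVanishes_one_of_exists_extend
    (baseChange_injective_of_isSMulRegular hsurj hker hf hfg hZ) hfgB hgB
    (extVanishes_of_projective 0) fun φ ↦ ?_
  obtain ⟨Φ, hΦ⟩ := exists_extend_of_extVanishes_one hf hfg hg h
    (φ.restrictScalars A ∘ₗ TensorProduct.mk A B X 1)
  refine ⟨Φ.liftBaseChange B, ?_⟩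
  ext k
  simpa using congr($hΦ k)

include hsurj hker in
lemma extVanishes_succ_baseChange [Module.Projective A Y] (hf : Function.Injective f)
    (hfg : Function.Exact f g) (hg : Function.Surjective g) [AddCommGroup I]
    [Module B I] (hZ : IsSMulRegular Z a) {i : ℕ} (h : ExtVanishes B (i + 1) (B ⊗[A] X) I) :
    ExtVanishes B (i + 2) (B ⊗[A] Z) I := by
  have hfgB : Function.Exact (f.baseChange B) (g.baseChange B) := lTensor_exact B hfg hg
  have hgB : Function.Surjective (g.baseChange B) := LinearMap.lTensor_surjective B hg
  exact extVanishes_left₃ (baseChange_injective_of_isSMulRegular hsurj hker hf hfg hZ) hfgB hgB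
    h (extVanishes_of_projective _)

include hsurj hker in
/-- If `a` is regular on `A` and on `X`, then the vanishing of `Ext_A(X, I)` implies the vanishing
of `Ext_{A/a}(X/aX, I)`. -/
lemma extVanishes_baseChange (ha : IsSMulRegular A a) [AddCommGroup I] [Module A I] [Module B I]
    [IsScalarTower A B I] (i : ℕ) (hX : IsSMulRegular X a) (h : ExtVanishes A (i + 1) X I) :
    ExtVanishes B (i + 1) (B ⊗[A] X) I := by
  induction i generalizing X with
  | zero =>
    obtain ⟨K, F, _, _, _, _, _, f, g, hf, hfg, hg⟩ := exists_projective_presentation A X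
    exact extVanishes_one_baseChange hsurj hker hf hfg hg hX h
  | succ i ih =>
    obtain ⟨K, F, _, _, _, _, _, f, g, hf, hfg, hg⟩ := exists_projective_presentation A X
    exact extVanishes_succ_baseChange hsurj hker hf hfg hg hX
      (ih (isSMulRegular_of_injective_of_flat hf ha)
        (extVanishes_left₁ hf hfg hg (extVanishes_of_projective i) h))

end

section

variable {N I K F : Type u} [AddCommGroup N] [Module A N] [Module B N] [IsScalarTower A B N]
  [AddCommGroup I] [Module A I] [Module B I] [IsScalarTower A B I]
  [AddCommGroup K] [Module A K] [AddCommGroup F] [Module A F]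
  {f : K →ₗ[A] F} {q : F →ₗ[A] N}

/-- The map from the base change of the syzygy over `A` to the syzygy over `B`. -/
noncomputable def syzygyComparison (B : Type u) [CommRing B] [Algebra A B] [Module B N]
    [IsScalarTower A B N] (hfq : Function.Exact f q) :
    (B ⊗[A] K) →ₗ[B] (q.liftBaseChange B).ker :=
  (f.baseChange B).codRestrict _ fun z ↦ by
    induction z with
    | zero => simp
    | add z w hz hw => rw [map_add]; exact add_mem hz hw
    | tmul b k =>
      rw [LinearMap.mem_ker, LinearMap.baseChange_tmul, LinearMap.liftBaseChange_tmul,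
        hfq.apply_apply_eq_zero, smul_zero]

lemma coe_syzygyComparison_one_tmul (hfq : Function.Exact f q) (k : K) :
    (syzygyComparison B hfq (1 ⊗ₜ k) : B ⊗[A] F) = 1 ⊗ₜ f k :=
  f.baseChange_tmul (1 : B) k

include hsurj in
lemma syzygyComparison_surjective (hfq : Function.Exact f q) :
    Function.Surjective (syzygyComparison B hfq) := by
  rintro ⟨z, hz⟩
  obtain ⟨x, rfl⟩ := TensorProduct.mk_surjective A F B hsurj z
  rw [LinearMap.mem_ker, TensorProduct.mk_apply, LinearMap.liftBaseChange_tmul, one_smul,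
    hfq] at hz
  obtain ⟨k, rfl⟩ := hz
  exact ⟨1 ⊗ₜ k, Subtype.ext (coe_syzygyComparison_one_tmul hfq k)⟩

include hsurj hker in
/-- The kernel of the map between syzygies is a copy of `N = Tor_1^A(B, N)`. -/
lemma exists_exact_syzygyComparison (hf : Function.Injective f) (hfq : Function.Exact f q)
    (hq : Function.Surjective q) (hF : IsSMulRegular F a) :
    ∃ v : N →ₗ[B] B ⊗[A] K, Function.Injective v ∧
      Function.Exact v (syzygyComparison B hfq) ∧
      ∀ x : F, ∃ k : K, f k = a • x ∧ v (q x) = 1 ⊗ₜ k := by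
  -- As `a` kills `N`, `a • x` comes from `K`. The map `v` is the snake-lemma connecting map `q x ↦
  -- 1 ⊗ f⁻¹(a • x)`.
  have hmem (x : F) : (a • LinearMap.id : F →ₗ[A] F) x ∈ f.range := by
    refine (hfq _).mp ?_
    rw [LinearMap.smul_apply, map_smul, smul_eq_zero_of_ker hker]
  let s : F →ₗ[A] K :=
    (LinearEquiv.ofInjective f hf).symm.toLinearMap ∘ₗ (a • LinearMap.id).codRestrict f.range hmem
  have hs (x) : f (s x) = a • x :=
    congr(($((LinearEquiv.ofInjective f hf).apply_symm_apply ⟨a • x, hmem x⟩) : F))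
  let w : F →ₗ[A] B ⊗[A] K := TensorProduct.mk A B K 1 ∘ₗ s
  have hw : q.ker ≤ w.ker := fun x hx ↦ by
    obtain ⟨k, rfl⟩ := (hfq x).mp hx
    refine (one_tmul_eq_zero_iff hsurj hker (s (f k))).mpr ⟨k, hf ?_⟩
    rw [hs, map_smul]
  let v : N →ₗ[A] B ⊗[A] K :=
    q.ker.liftQ w hw ∘ₗ (q.quotKerEquivOfSurjective hq).symm.toLinearMap
  have hv (x) : v (q x) = 1 ⊗ₜ s x := by
    have : (q.quotKerEquivOfSurjective hq).symm (q x) = q.ker.mkQ x := by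
      rw [LinearEquiv.symm_apply_eq]
      rfl
    simp only [v, LinearMap.comp_apply, LinearEquiv.coe_coe, this]
    rfl
  refine ⟨v.extendScalarsOfSurjective hsurj, ?_, ?_, fun x ↦ ⟨s x, hs x, hv x⟩⟩
  · rw [injective_iff_map_eq_zero]
    intro n hn
    obtain ⟨x, rfl⟩ := hq n
    change v (q x) = 0 at hn
    rw [hv] at hn
    obtain ⟨k, hk⟩ := (one_tmul_eq_zero_iff hsurj hker (s x)).mp hn
    refine (hfq x).mpr ⟨k, hF ?_⟩
    change a • f k = a • x
    rw [← map_smul, hk, hs]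
  · intro z
    obtain ⟨k, rfl⟩ := TensorProduct.mk_surjective A K B hsurj z
    rw [TensorProduct.mk_apply, ← Subtype.coe_inj, coe_syzygyComparison_one_tmul,
      ZeroMemClass.coe_zero, one_tmul_eq_zero_iff hsurj hker]
    constructor
    · rintro ⟨y, hy⟩
      refine ⟨q y, (hv y).trans congr(1 ⊗ₜ $(hf ?_))⟩
      rw [hs, hy]
    · rintro ⟨n, hn⟩
      obtain ⟨x, rfl⟩ := hq n
      change v (q x) = _ at hn
      rw [hv, eq_comm, ← sub_eq_zero, ← TensorProduct.tmul_sub,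
        one_tmul_eq_zero_iff hsurj hker] at hn
      obtain ⟨k', hk'⟩ := hn
      refine ⟨f k' + x, ?_⟩
      rw [smul_add, ← map_smul, hk', map_sub, hs, sub_add_cancel]

include hsurj hker in
/-- Let `B = A/(a)` with `a` a nonzerodivisor, and let `N`, `I` be `B`-modules. If the `Ext_A(N, I)`
in odd degrees vanish, then so do the `Ext_B(N, I)` in odd degrees, while those in even degrees do
not vanish unless `Hom(N, I) = 0`. -/
lemma extVanishes_odd_and_not_even (ha : IsSMulRegular A a)
    (h : ∀ i, ExtVanishes A (2 * i + 1) N I) :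
    (∀ i, ExtVanishes B (2 * i + 1) N I) ∧
      (Nontrivial (N →ₗ[B] I) → ∀ i, ¬ ExtVanishes B (2 * i) N I) := by
  obtain ⟨K, F, _, _, _, _, _, f, q, hf, hfq, hq⟩ := exists_projective_presentation A N
  obtain ⟨v, hvinj, hvex, hv⟩ :=
    exists_exact_syzygyComparison hsurj hker hf hfq hq (isSMulRegular_of_flat ha)
  have hu := syzygyComparison_surjective hsurj hfq
  have hp : Function.Surjective (q.liftBaseChange B) := fun n ↦
    have ⟨x, hx⟩ := hq n
    ⟨1 ⊗ₜ x, by rw [LinearMap.liftBaseChange_tmul, one_smul, hx]⟩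
  refine extVanishes_of_two_periodic (L := (q.liftBaseChange B).ker) hvinj hvex hu
    (q.liftBaseChange B).ker.injective_subtype (q.liftBaseChange B).exact_subtype_ker_map
    hp (fun i ↦ ?_) (fun φ ↦ ?_) (fun Φ ↦ ?_)
  -- `Ext_A^{2i+3}(N) = 0` shifts to `Ext_A^{2i+2}(K) = 0`, which descends to `B` because `a` is
  -- regular on `K ⊆ F`.
  · exact extVanishes_baseChange hsurj hker ha _ (isSMulRegular_of_injective_of_flat hf ha)
      (extVanishes_left₁ hf hfq hq (extVanishes_of_projective _) (h (i + 1)))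
  · obtain ⟨Φ, hΦ⟩ := exists_extend_of_extVanishes_one hf hfq hq (h 0)
      ((φ ∘ₗ syzygyComparison B hfq).restrictScalars A ∘ₗ TensorProduct.mk A B K 1)
    refine ⟨Φ.liftBaseChange B, LinearMap.ext fun l ↦ ?_⟩
    obtain ⟨z, rfl⟩ := hu l
    obtain ⟨k, rfl⟩ := TensorProduct.mk_surjective A K B hsurj z
    have : Φ (f k) = φ (syzygyComparison B hfq (1 ⊗ₜ k)) := congr($hΦ k)
    rw [TensorProduct.mk_apply, ← this, LinearMap.comp_apply, Submodule.subtype_apply,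
      coe_syzygyComparison_one_tmul, LinearMap.liftBaseChange_tmul, one_smul]
  -- With `Ψ` extending `Φ` to `F`, `Φ (v (q x)) = Ψ (a • x) = a • Ψ x = 0`, since `a` kills `I`.
  · obtain ⟨Ψ, hΨ⟩ := exists_extend_of_extVanishes_one hf hfq hq (h 0)
      (Φ.restrictScalars A ∘ₗ TensorProduct.mk A B K 1)
    ext n
    obtain ⟨x, rfl⟩ := hq n
    obtain ⟨k, hk, hvk⟩ := hv x
    have h3 : Ψ (f k) = Φ (1 ⊗ₜ k) := congr($hΨ k)
    rw [hk, map_smul, smul_eq_zero_of_ker hker] at h3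
    exact congr(Φ $hvk).trans h3.symm

end

end ChangeOfRings

/-! ### Dividing out the whole regular sequence. -/

section List

open RingTheory.Sequence

/-- Let `R = A/(a₁, …, aᵣ)` with `r ≥ 1` and `a₁, …, aᵣ` a regular sequence, and let `N`, `I` be
`R`-modules with `Hom(N, I) ≠ 0`. If the `Ext_A(N, I)` in odd degrees vanish, then the
`Ext_R(N, I)` vanish precisely in odd degrees. -/
lemma extVanishes_iff_odd_of_isWeaklyRegular {R : Type u} [CommRing R] {N I : Type u}
    [AddCommGroup N] [Module R N] [AddCommGroup I] [Module R I] [Nontrivial (N →ₗ[R] I)]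
    {A : Type u} [CommRing A] [Algebra A R] [Module A N] [Module A I] [IsScalarTower A R N]
    [IsScalarTower A R I]
    (hsurj : Function.Surjective (algebraMap A R)) (fs : List A) (hne : fs ≠ [])
    (hfs : IsWeaklyRegular A fs) (hker : RingHom.ker (algebraMap A R) = Ideal.ofList fs)
    (h : ∀ i, ExtVanishes A (2 * i + 1) N I) (i : ℕ) : ExtVanishes R i N I ↔ ¬ Even i := by
  -- The induction is on the length, with the ring varying, because the tail is replaced by its
  -- image in `A/(a)`. Only odd vanishing is passed on; even nonvanishing is read off at the last
  -- element.
  obtain ⟨n, hn⟩ : ∃ n, fs.length = n := ⟨_, rfl⟩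
  induction n generalizing A with
  | zero => exact absurd (List.length_eq_zero_iff.mp hn) hne
  | succ n ih =>
    obtain _ | ⟨a, fs⟩ := fs
    · simp at hne
    rw [isWeaklyRegular_cons_iff] at hfs
    by_cases hfs0 : fs = []
    · rw [hfs0, Ideal.ofList_singleton] at hker
      obtain ⟨h1, h2⟩ := extVanishes_odd_and_not_even hsurj hker hfs.1 h
      obtain ⟨k, rfl | rfl⟩ := Nat.even_or_odd' i
      · simpa using h2 inferInstance k
      · simpa using h1 k
    · have hle : Ideal.span {a} ≤ RingHom.ker (algebraMap A R) := by
        rw [hker, Ideal.ofList_cons]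
        exact le_sup_left
      let φ : A ⧸ Ideal.span {a} →+* R := Ideal.Quotient.lift _ (algebraMap A R) hle
      let : Algebra (A ⧸ Ideal.span {a}) R := φ.toAlgebra
      let : Module (A ⧸ Ideal.span {a}) N := Module.compHom N φ
      let : Module (A ⧸ Ideal.span {a}) I := Module.compHom I φ
      have : IsScalarTower (A ⧸ Ideal.span {a}) R N := .of_algebraMap_smul fun _ _ ↦ rfl
      have : IsScalarTower (A ⧸ Ideal.span {a}) R I := .of_algebraMap_smul fun _ _ ↦ rfl
      have : IsScalarTower A (A ⧸ Ideal.span {a}) N :=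
        .of_algebraMap_smul fun b x ↦ algebraMap_smul R b x
      have : IsScalarTower A (A ⧸ Ideal.span {a}) I :=
        .of_algebraMap_smul fun b x ↦ algebraMap_smul R b x
      have hsurj' : Function.Surjective (algebraMap (A ⧸ Ideal.span {a}) R) :=
        Ideal.Quotient.lift_surjective_of_surjective _ hle hsurj
      refine ih hsurj' (fs.map (Ideal.Quotient.mk (Ideal.span {a}))) (by simpa using hfs0) ?_ ?_
        (extVanishes_odd_and_not_even (B := A ⧸ Ideal.span {a}) Ideal.Quotient.mk_surjective
          Ideal.mk_ker hfs.1 h).1 (by simpa using hn)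
      · refine (isWeaklyRegular_map_algebraMap_iff (R := A) (A ⧸ Ideal.span {a})
          (A ⧸ Ideal.span {a}) fs).mpr ?_
        refine (LinearEquiv.isWeaklyRegular_congr (Submodule.quotEquivOfEq _ _ ?_) fs).mp hfs.2
        rw [← Submodule.ideal_span_singleton_smul, smul_eq_mul, Ideal.mul_top]
      · rw [← Ideal.map_ofList]
        refine (Ideal.ker_quotient_lift _ hle).trans ?_
        rw [hker, Ideal.ofList_cons, Ideal.map_sup, Ideal.map_quotient_self, bot_sup_eq]

end List

/-! ### Character modules: exactness and injective dimension. -/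

section Dual

variable {A : Type u} [CommRing A]

lemma characterModule_isScalarTower (S R M : Type*) [CommRing S] [CommRing R] [Algebra S R]
    [AddCommGroup M] [Module R M] [Module S M] [IsScalarTower S R M] :
    IsScalarTower S R (CharacterModule M) :=
  .of_algebraMap_smul fun s c ↦ by ext m; simp

lemma subsingleton_characterModule_iff {X : Type*} [AddCommGroup X] :
    Subsingleton (CharacterModule X) ↔ Subsingleton X :=
  ⟨fun _ ↦ subsingleton_of_forall_eq 0 fun _ ↦ CharacterModule.eq_zero_of_character_apply
    fun c ↦ congr($(Subsingleton.elim c 0) _),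
  fun _ ↦ ⟨fun c d ↦ by ext x; rw [Subsingleton.elim x 0, map_zero, map_zero]⟩⟩

lemma subsingleton_linearMap_characterModule_iff {X Y : Type*} [AddCommGroup X] [Module A X]
    [AddCommGroup Y] [Module A Y] :
    Subsingleton (X →ₗ[A] CharacterModule Y) ↔ Subsingleton (X ⊗[A] Y) := by
  rw [CharacterModule.homEquiv.toEquiv.subsingleton_congr, subsingleton_characterModule_iff]

section

variable {X Y Z : Type*} [AddCommGroup X] [Module A X] [AddCommGroup Y] [Module A Y]
  [AddCommGroup Z] [Module A Z] {f : X →ₗ[A] Y} {g : Y →ₗ[A] Z}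

/-- A character of `Y` killing the image of `f` factors through the range of `g`, and extends to `Z`
by injectivity of `ℚ/ℤ`. -/
lemma CharacterModule.dual_exact (h : Function.Exact f g) :
    Function.Exact (CharacterModule.dual g) (CharacterModule.dual f) := by
  intro c
  constructor
  · intro hc
    have hker : g.rangeRestrict.toAddMonoidHom.ker ≤ AddMonoidHom.ker c := by
      intro y hy
      obtain ⟨x, rfl⟩ := (h y).mp congr(($hy : Z))
      exact congr($hc x)
    let d : CharacterModule g.range := AddMonoidHom.liftOfSurjective
      g.rangeRestrict.toAddMonoidHom g.surjective_rangeRestrict ⟨c, hker⟩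
    obtain ⟨e, he⟩ := CharacterModule.dual_surjective_of_injective g.range.subtype
      g.range.injective_subtype d
    refine ⟨e, ?_⟩
    ext y
    refine (congr($he (g.rangeRestrict y)) : _).trans ?_
    exact AddMonoidHom.liftOfRightInverse_comp_apply g.rangeRestrict.toAddMonoidHom _ _
      ⟨c, hker⟩ y
  · rintro ⟨d, rfl⟩
    rw [← LinearMap.comp_apply, ← CharacterModule.dual_comp, h.linearMap_comp_eq_zero,
      CharacterModule.dual_zero, LinearMap.zero_apply]

lemma CharacterModule.exact_of_dual_exact (h0 : g ∘ₗ f = 0)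
    (h : Function.Exact (CharacterModule.dual g) (CharacterModule.dual f)) :
    Function.Exact f g := by
  intro y
  refine ⟨fun hy ↦ ?_, ?_⟩
  · by_contra hyf
    obtain ⟨c, hc⟩ := CharacterModule.exists_character_apply_ne_zero_of_ne_zero
      (a := f.range.mkQ y) (by simpa using hyf)
    obtain ⟨d, hd⟩ := (h (CharacterModule.dual f.range.mkQ c)).mp (by
      rw [← LinearMap.comp_apply, ← CharacterModule.dual_comp, LinearMap.range_mkQ_comp,
        CharacterModule.dual_zero, LinearMap.zero_apply])
    refine hc ((congr($hd y) : d (g y) = _).symm.trans ?_)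
    rw [hy, map_zero]
  · rintro ⟨x, rfl⟩
    exact congr($h0 x)

lemma CharacterModule.dual_rTensor_homEquiv {M : Type*} [AddCommGroup M] [Module A M]
    (f : X →ₗ[A] Y) (φ : Y →ₗ[A] CharacterModule M) :
    CharacterModule.dual (f.rTensor M) (CharacterModule.homEquiv φ) =
      CharacterModule.homEquiv (φ ∘ₗ f) :=
  (LinearEquiv.symm_apply_eq _).mp
    congr($(CharacterModule.dual_rTensor_conj_homEquiv (B := M) (f := f)) φ)

/-- Exactness of a sequence after tensoring with `M` is detected by the maps into the dual
of `M`. -/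
lemma rTensor_exact_iff_lcomp_exact {M : Type*} [AddCommGroup M] [Module A M] (h0 : g ∘ₗ f = 0) :
    Function.Exact (f.rTensor M) (g.rTensor M) ↔
      ∀ φ : Y →ₗ[A] CharacterModule M, φ ∘ₗ f = 0 → ∃ ψ : Z →ₗ[A] CharacterModule M, ψ ∘ₗ g = φ := by
  have hdual : Function.Exact (f.rTensor M) (g.rTensor M) ↔ Function.Exact
      (CharacterModule.dual (g.rTensor M)) (CharacterModule.dual (f.rTensor M)) :=
    ⟨CharacterModule.dual_exact, CharacterModule.exact_of_dual_exact (by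
      rw [← LinearMap.rTensor_comp, h0, LinearMap.rTensor_zero])⟩
  rw [hdual]
  constructor
  · intro h φ hφ
    obtain ⟨c, hc⟩ := (h (CharacterModule.homEquiv φ)).mp (by
      rw [CharacterModule.dual_rTensor_homEquiv, hφ, map_zero])
    obtain ⟨ψ, rfl⟩ := CharacterModule.homEquiv.surjective c
    rw [CharacterModule.dual_rTensor_homEquiv] at hc
    exact ⟨ψ, CharacterModule.homEquiv.injective hc⟩
  · intro h c
    obtain ⟨φ, rfl⟩ := CharacterModule.homEquiv.surjective c
    constructor
    · intro hφ
      rw [CharacterModule.dual_rTensor_homEquiv, LinearEquiv.map_eq_zero_iff] at hφ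
      obtain ⟨ψ, rfl⟩ := h φ hφ
      exact ⟨CharacterModule.homEquiv ψ, CharacterModule.dual_rTensor_homEquiv g ψ⟩
    · rintro ⟨d, hd⟩
      obtain ⟨ψ, rfl⟩ := CharacterModule.homEquiv.surjective d
      rw [CharacterModule.dual_rTensor_homEquiv, CharacterModule.homEquiv.injective.eq_iff] at hd
      rw [CharacterModule.dual_rTensor_homEquiv, ← hd, LinearMap.comp_assoc, h0,
        LinearMap.comp_zero, map_zero]

end

/-- If `M` has projective dimension at most `p`, then its dual has injective dimension at
most `p`. -/
lemma extVanishes_characterModule {M : Type u} [AddCommGroup M] [Module A M] {p : ℕ}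
    (hM : HasProjectiveDimensionLE (ModuleCat.of A M) p) (i : ℕ) (hi : p < i) (W : Type u)
    [AddCommGroup W] [Module A W] : ExtVanishes A i W (CharacterModule M) := by
  induction p generalizing M i with
  | zero =>
    have : Module.Projective A M :=
      (IsProjective.iff_projective M).mpr ((projective_iff_hasProjectiveDimensionLE_zero _).mpr hM)
    have : Module.Injective A (CharacterModule M) :=
      Module.Flat.iff_characterModule_injective.mp inferInstance
    have : Injective (ModuleCat.of A (CharacterModule M)) :=
      Module.injective_object_of_injective_module A _
    obtain ⟨i, rfl⟩ := Nat.exists_eq_add_of_lt hi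
    exact subsingleton_of_forall_eq 0 fun e ↦ Ext.eq_zero_of_injective (n := 0 + i) e
  | succ p ih =>
    obtain ⟨K, F, _, _, _, _, _, f, g, hf, hfg, hg⟩ := exists_projective_presentation A M
    have hF : Projective (ModuleCat.of A F) := (IsProjective.iff_projective F).mp inferInstance
    have hK : HasProjectiveDimensionLE (ModuleCat.of A K) p :=
      ((moduleCatMk_shortExact hf hfg hg).hasProjectiveDimensionLT_X₃_iff p hF).mp hM
    have hF' : HasProjectiveDimensionLE (ModuleCat.of A F) p := by
      have : HasProjectiveDimensionLT (ModuleCat.of A F) 1 := inferInstance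
      exact hasProjectiveDimensionLT_of_ge _ 1 _ (by lia)
    obtain ⟨i, rfl⟩ := Nat.exists_eq_succ_of_ne_zero (Nat.ne_zero_of_lt hi)
    exact extVanishes_right₁ (CharacterModule.dual_injective_of_surjective g hg)
      (CharacterModule.dual_exact hfg) (CharacterModule.dual_surjective_of_injective f hf)
      (ih hK i (by lia)) (ih hF' (i + 1) (by lia))

end Dual

/-! ### Half of the Auslander–Buchsbaum formula. -/

section Local

variable {A : Type u} [CommRing A] [IsLocalRing A] [IsNoetherianRing A]

/-- If `Tor_n(k, M) = 0` for a finitely generated module `M` of projective dimension at most `n`,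
then `M` has projective dimension less than `n`. -/
lemma hasProjectiveDimensionLT_of_extVanishes {M : Type u} [AddCommGroup M] [Module A M]
    [Module.Finite A M] (n : ℕ) (hM : HasProjectiveDimensionLE (ModuleCat.of A M) n)
    (h : ExtVanishes A n (ResidueField A) (CharacterModule M)) :
    HasProjectiveDimensionLT (ModuleCat.of A M) n := by
  induction n generalizing M with
  | zero =>
    rw [extVanishes_zero_iff, subsingleton_linearMap_characterModule_iff,
      IsLocalRing.subsingleton_tensorProduct] at h
    exact (ModuleCat.isZero_of_subsingleton _).hasProjectiveDimensionLT_zero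
  | succ n ih =>
    cases n with
    | zero =>
      have hfree : Module.Free A M := by
        have : Module.FinitePresentation A M := Module.finitePresentation_of_finite A M
        -- By duality, `Ext^1(k, M^∨) = 0` makes `𝔪 ⊗ M → A ⊗ M` injective, the local criterion for
        -- freeness.
        refine Module.free_of_maximalIdeal_rTensor_injective
          (rTensor_injective_iff_lcomp_surjective.mpr fun φ ↦ ?_)
        exact exists_extend_of_extVanishes_one (maximalIdeal A).injective_subtype
          (LinearMap.exact_subtype_mkQ _) (Submodule.mkQ_surjective (maximalIdeal A)) h φ
      have : Projective (ModuleCat.of A M) := (IsProjective.iff_projective M).mp inferInstance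
      exact projective_iff_hasProjectiveDimensionLT_one.mp this
    | succ n =>
      obtain ⟨F, _, _, _, _, g, hg⟩ := Module.exists_finite_presentation A M
      have hF : Projective (ModuleCat.of A F) := (IsProjective.iff_projective F).mp inferInstance
      have hS := moduleCatMk_shortExact g.ker.injective_subtype g.exact_subtype_ker_map hg
      have hF0 : HasProjectiveDimensionLE (ModuleCat.of A F) 0 :=
        (projective_iff_hasProjectiveDimensionLE_zero _).mp hF
      have hK : HasProjectiveDimensionLE (ModuleCat.of A g.ker) (n + 1) :=
        (hS.hasProjectiveDimensionLT_X₃_iff (n + 1) hF).mp hM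
      have hK' : ExtVanishes A (n + 1) (ResidueField A) (CharacterModule g.ker) :=
        extVanishes_right₃ (CharacterModule.dual_injective_of_surjective g hg)
          (CharacterModule.dual_exact g.exact_subtype_ker_map)
          (CharacterModule.dual_surjective_of_injective g.ker.subtype g.ker.injective_subtype)
          (extVanishes_characterModule hF0 _ (by lia) _) h
      exact (hS.hasProjectiveDimensionLT_X₃_iff n hF).mpr (ih hK hK')

open RingTheory.Sequence

/-- `ys` is an `A`-regular sequence in the maximal ideal which cannot be extended. -/
structure IsMaximalRegular (A : Type u) [CommRing A] [IsLocalRing A] (ys : List A) : Prop where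
  isWeaklyRegular : IsWeaklyRegular A ys
  mem : ∀ y ∈ ys, y ∈ maximalIdeal A
  not_isSMulRegular : ∀ x ∈ maximalIdeal A,
    ¬ IsSMulRegular (A ⧸ (Ideal.ofList ys • (⊤ : Submodule A A))) x

variable (A) in
-- Noetherianity gives a maximal ideal among those generated by regular sequences. A further regular
-- `x` would already lie in it, so it would be both zero and regular on a nonzero quotient.
lemma exists_isMaximalRegular : ∃ ys : List A, IsMaximalRegular A ys := by
  obtain ⟨I, ⟨ys, hreg, hmem, rfl⟩, hmax⟩ := wellFounded_gt.has_min
    {I : Ideal A | ∃ ys : List A, IsWeaklyRegular A ys ∧ (∀ y ∈ ys, y ∈ maximalIdeal A) ∧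
      Ideal.ofList ys = I} ⟨_, [], .nil A A, by simp, rfl⟩
  refine ⟨ys, hreg, hmem, fun x hx hxreg ↦ ?_⟩
  have hle : Ideal.ofList ys ≤ maximalIdeal A := Ideal.span_le.mpr hmem
  have hx' : x ∈ Ideal.ofList ys := by
    have h2 := hmax _ ⟨ys ++ [x], (isWeaklyRegular_append_iff A ys [x]).mpr
      ⟨hreg, (isWeaklyRegular_singleton_iff _ x).mpr hxreg⟩, fun y hy ↦ ?_, rfl⟩
    · rw [Ideal.ofList_append] at h2
      have h3 : Ideal.ofList ys = Ideal.ofList ys ⊔ Ideal.ofList [x] :=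
        eq_of_le_of_not_lt le_sup_left h2
      rw [h3, Ideal.ofList_singleton]
      exact le_sup_right (a := Ideal.ofList ys) (Ideal.mem_span_singleton_self x)
    · rcases List.mem_append.mp hy with hy | hy
      · exact hmem y hy
      · rwa [List.mem_singleton.mp hy]
  have h1 : Submodule.Quotient.mk (p := Ideal.ofList ys • (⊤ : Submodule A A)) (1 : A) = 0 := by
    refine hxreg ?_
    change x • Submodule.Quotient.mk (1 : A) = x • 0
    rw [← Submodule.Quotient.mk_smul, smul_zero, Submodule.Quotient.mk_eq_zero]
    exact Submodule.smul_mem_smul hx' trivial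
  rw [Submodule.Quotient.mk_eq_zero, smul_eq_mul, Ideal.mul_top] at h1
  exact (Ideal.ne_top_iff_one _).mp (maximalIdeal.isMaximal A).ne_top (hle h1)

/-- One half of the Auslander–Buchsbaum formula: the projective dimension, if finite, is bounded by
the length of any maximal regular sequence. -/
lemma le_length_of_not_hasProjectiveDimensionLT {ys : List A} (hys : IsMaximalRegular A ys)
    {M : Type u} [AddCommGroup M] [Module A M] [Module.Finite A M] {p : ℕ}
    (hM : HasProjectiveDimensionLE (ModuleCat.of A M) p)
    (hM' : ¬ HasProjectiveDimensionLT (ModuleCat.of A M) p) : p ≤ ys.length := by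
  by_contra! hlt
  refine hM' (hasProjectiveDimensionLT_of_extVanishes p hM ?_)
  -- The quotient `C = A/(ys)` has depth zero, so `k` embeds in it. Then `Ext^p(k, M^∨)` sits
  -- between `Ext^p(C, M^∨)`, zero as `pd C = ys.length < p`, and an `Ext^{p+1}` into `M^∨`.
  obtain ⟨g, hg⟩ : ∃ g : ResidueField A →ₗ[A] A ⧸ (Ideal.ofList ys • (⊤ : Submodule A A)),
      Function.Injective g := by
    have : Nontrivial (ResidueField A →ₗ[A] A ⧸ (Ideal.ofList ys • (⊤ : Submodule A A))) := by
      by_contra hsub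
      rw [not_nontrivial_iff_subsingleton, IsSMulRegular.subsingleton_linearMap_iff] at hsub
      obtain ⟨r, hr, hreg⟩ := hsub
      refine hys.not_isSMulRegular r ?_ hreg
      rwa [← Ideal.annihilator_quotient (I := maximalIdeal A)]
    obtain ⟨g, hg⟩ := exists_ne (0 : ResidueField A →ₗ[A]
      A ⧸ (Ideal.ofList ys • (⊤ : Submodule A A)))
    have : IsSimpleModule A (ResidueField A) :=
      isSimpleModule_iff_isCoatom.mpr (maximalIdeal.isMaximal A).out
    exact ⟨g, g.injective_or_eq_zero.resolve_right hg⟩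
  have hC : HasProjectiveDimensionLT
      (ModuleCat.of A (A ⧸ (Ideal.ofList ys • (⊤ : Submodule A A)))) p := by
    rw [← projectiveDimension_lt_iff,
      ModuleCat.projectiveDimension_quotient_eq_add_length_of_isWeaklyRegular
        (ModuleCat.of A A) ys hys.isWeaklyRegular hys.mem,
      ModuleCat.projectiveDimension_eq_zero_of_projective, zero_add]
    exact_mod_cast hlt
  exact extVanishes_left₁ hg g.exact_map_mkQ_range (Submodule.mkQ_surjective _)
    (HasProjectiveDimensionLT.subsingleton _ p p le_rfl _)
    (extVanishes_characterModule hM _ (by lia) _)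

/-- A form of the inequality `pd M + depth M ≤ depth A`. -/
lemma exists_hasProjectiveDimensionLE_add_length_le {ys : List A} (hys : IsMaximalRegular A ys)
    {M : Type u} [AddCommGroup M] [Module A M] [Module.Finite A M] [Nontrivial M]
    (hM : ∃ n, HasProjectiveDimensionLE (ModuleCat.of A M) n) :
    ∃ p, HasProjectiveDimensionLE (ModuleCat.of A M) p ∧ ∀ xs : List A, IsWeaklyRegular M xs →
      (∀ x ∈ xs, x ∈ maximalIdeal A) → xs.length + p ≤ ys.length := by
  classical
  have hle := Nat.find_spec hM
  set p := Nat.find hM with hp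
  have hnot : ¬ HasProjectiveDimensionLT (ModuleCat.of A M) p := by
    intro hlt
    obtain _ | q := p
    · exact not_subsingleton M (ModuleCat.isZero_iff_subsingleton.mp
        (isZero_of_hasProjectiveDimensionLT_zero (ModuleCat.of A M)))
    · exact Nat.find_min hM (m := q) (by lia) hlt
  have hpd : projectiveDimension (ModuleCat.of A M) = p :=
    le_antisymm ((projectiveDimension_le_iff _ _).mpr hle)
      ((projectiveDimension_ge_iff _ _).mpr hnot)
  refine ⟨p, hle, fun xs hxs hmem ↦ ?_⟩
  -- `pd (M/xs M) = p + xs.length`, and the bound by `ys.length` applies to this quotient too.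
  have hq := ModuleCat.projectiveDimension_quotient_eq_add_length_of_isWeaklyRegular
    (ModuleCat.of A M) xs hxs hmem
  rw [hpd, ← Nat.cast_add, add_comm] at hq
  exact le_length_of_not_hasProjectiveDimensionLT hys ((projectiveDimension_le_iff _ _).mp hq.le)
    ((projectiveDimension_ge_iff _ _).mp hq.ge)

end Local

/-! ### Annihilators and supports of tensor products. -/

section Support

/-- If a power of `x` kills `M ⊗ N`, then a power of `x` lies in `Ann M + Ann N`. -/
lemma exists_pow_mem_annihilator_sup {R M N : Type*} [CommRing R] [AddCommGroup M] [Module R M]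
    [AddCommGroup N] [Module R N] [Module.Finite R M] [Module.Finite R N] {x : R} {n : ℕ}
    (h : ∀ t : M ⊗[R] N, x ^ n • t = 0) :
    ∃ k, x ^ k ∈ Module.annihilator R M ⊔ Module.annihilator R N := by
  -- At a prime containing both annihilators but not `x`, the fibre of `M ⊗ N` is a nonzero vector
  -- space on which `x ^ n` is both invertible and zero.
  change x ∈ (Module.annihilator R M ⊔ Module.annihilator R N).radical
  rw [Ideal.radical_eq_sInf, Ideal.mem_sInf]
  rintro P ⟨hle, hP⟩
  by_contra hx
  let p : PrimeSpectrum R := ⟨P, hP⟩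
  have hM : Nontrivial (P.ResidueField ⊗[R] M) :=
    (Module.mem_support_iff_nontrivial_residueField_tensorProduct p).mp
      (Module.mem_support_iff_of_finite.mpr (le_sup_left.trans hle))
  have hN : Nontrivial (P.ResidueField ⊗[R] N) :=
    (Module.mem_support_iff_nontrivial_residueField_tensorProduct p).mp
      (Module.mem_support_iff_of_finite.mpr (le_sup_right.trans hle))
  have e := AlgebraTensorModule.distribBaseChange R P.ResidueField M N
  have hMN : Nontrivial (P.ResidueField ⊗[R] (M ⊗[R] N)) := e.toEquiv.nontrivial
  have hu : algebraMap R P.ResidueField (x ^ n) ≠ 0 := by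
    rw [map_pow]
    exact pow_ne_zero _ (by rwa [ne_eq, Ideal.algebraMap_residueField_eq_zero])
  refine not_subsingleton (P.ResidueField ⊗[R] (M ⊗[R] N)) (subsingleton_of_forall_eq 0 fun z ↦ ?_)
  have hz : x ^ n • z = 0 := by
    induction z with
    | zero => simp
    | add z w hz hw => rw [smul_add, hz, hw, add_zero]
    | tmul c t => rw [← TensorProduct.tmul_smul, h, TensorProduct.tmul_zero]
  rw [← algebraMap_smul P.ResidueField] at hz
  exact (smul_eq_zero.mp hz).resolve_left hu

open Pointwise in
/-- A module of finite length over a local ring is killed by a power of each element of the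
maximal ideal. -/
lemma exists_pow_smul_eq_zero {R T : Type*} [CommRing R] [IsLocalRing R] [AddCommGroup T]
    [Module R T] (hT : IsFiniteLength R T) {x : R} (hx : x ∈ maximalIdeal R) :
    ∃ n, ∀ t : T, x ^ n • t = 0 := by
  obtain ⟨_, _⟩ := isFiniteLength_iff_isNoetherian_isArtinian.mp hT
  let c : ℕ →o (Submodule R T)ᵒᵈ :=
    ⟨fun n ↦ OrderDual.toDual (x ^ n • ⊤), monotone_nat_of_le_succ fun n ↦ by
      rw [OrderDual.toDual_le_toDual, pow_succ, mul_smul]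
      exact smul_mono_right _ le_top⟩
  obtain ⟨n, hn⟩ := IsArtinian.monotone_stabilizes c
  have h1 : x ^ n • (⊤ : Submodule R T) = x • x ^ n • ⊤ := by
    rw [← mul_smul, ← pow_succ']
    exact hn (n + 1) (by lia)
  have h2 : x ^ n • (⊤ : Submodule R T) = ⊥ :=
    Submodule.eq_bot_of_eq_pointwise_smul_of_mem_jacobson_annihilator (IsNoetherian.noetherian _) h1
      (maximalIdeal_le_jacobson _ hx)
  refine ⟨n, fun t ↦ ?_⟩
  rw [← Submodule.mem_bot R, ← h2]
  exact Submodule.smul_mem_pointwise_smul _ _ _ trivial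

lemma nontrivial_tensorProduct_of_isLocalRing {R M N : Type*} [CommRing R] [IsLocalRing R]
    [AddCommGroup M] [Module R M] [AddCommGroup N] [Module R N] [Module.Finite R M]
    [Module.Finite R N] [Nontrivial M] [Nontrivial N] : Nontrivial (M ⊗[R] N) := by
  have hM : Nontrivial (ResidueField R ⊗[R] M) := by
    rwa [← not_subsingleton_iff_nontrivial, IsLocalRing.subsingleton_tensorProduct,
      not_subsingleton_iff_nontrivial]
  have hN : Nontrivial (ResidueField R ⊗[R] N) := by
    rwa [← not_subsingleton_iff_nontrivial, IsLocalRing.subsingleton_tensorProduct,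
      not_subsingleton_iff_nontrivial]
  have hMN : Nontrivial (ResidueField R ⊗[R] (M ⊗[R] N)) :=
    (AlgebraTensorModule.distribBaseChange R (ResidueField R) M N).toEquiv.nontrivial
  by_contra h
  rw [not_nontrivial_iff_subsingleton] at h
  exact not_subsingleton (ResidueField R ⊗[R] (M ⊗[R] N)) inferInstance

end Support

/-! ### `Tor` against `Ext` into the dual. -/

section TorDual

variable {R : Type u} [CommRing R] {M N : Type u} [AddCommGroup M] [Module R M] [AddCommGroup N]
  [Module R N]

open MonoidalCategory in
lemma nontrivial_torModule_zero_iff :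
    Nontrivial (torModule R 0 M N) ↔ Nontrivial (M ⊗[R] N) :=
  (((tensoringLeft (ModuleCat.{u} R)).obj (ModuleCat.of R M)).leftDerivedZeroIsoSelf.app
    (ModuleCat.of R N)).toLinearEquiv.toEquiv.nontrivial_congr

/-- The vanishing of `Tor_i(M, N)` in terms of the vanishing of `Ext^i(N, M^∨)`, for `i > 0`. -/
lemma subsingleton_torModule_succ_iff (i : ℕ) :
    Subsingleton (torModule R (i + 1) M N) ↔ ExtVanishes R (i + 1) N (CharacterModule M) := by
  -- One resolution of `N` computes both sides; exactness of `M ⊗ P` is tested by maps into `M^∨`.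
  let P := projectiveResolution (ModuleCat.of R N)
  have h0 : (P.complex.d (i + 1) i).hom ∘ₗ (P.complex.d (i + 2) (i + 1)).hom = 0 :=
    congr(ModuleCat.Hom.hom $(P.complex.d_comp_d (i + 2) (i + 1) i))
  have hTor : Subsingleton (torModule R (i + 1) M N) ↔
      Function.Exact ((P.complex.d (i + 2) (i + 1)).hom.lTensor M)
        ((P.complex.d (i + 1) i).hom.lTensor M) := by
    rw [← ModuleCat.isZero_iff_subsingleton]
    refine (P.isoLeftDerivedObj
      ((MonoidalCategory.tensoringLeft (ModuleCat.{u} R)).obj (ModuleCat.of R M))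
      (i + 1)).isZero_iff.trans ?_
    refine (HomologicalComplex.exactAt_iff_isZero_homology _ _).symm.trans ?_
    refine (HomologicalComplex.exactAt_iff' _ (i + 2) (i + 1) i (by simp) (by simp)).trans ?_
    exact ShortComplex.ShortExact.moduleCat_exact_iff_function_exact _
  have hExt : ExtVanishes R (i + 1) N (CharacterModule M) ↔
      ∀ φ : P.complex.X (i + 1) →ₗ[R] CharacterModule M,
        φ ∘ₗ (P.complex.d (i + 2) (i + 1)).hom = 0 →
          ∃ ψ : P.complex.X i →ₗ[R] CharacterModule M, ψ ∘ₗ (P.complex.d (i + 1) i).hom = φ := by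
    constructor
    · intro h φ hφ
      obtain ⟨g, hg⟩ := (P.extMk_eq_zero_iff (ModuleCat.ofHom φ) (i + 2) rfl (ModuleCat.hom_ext hφ)
        i rfl).mp (h.elim _ _)
      exact ⟨g.hom, congr(ModuleCat.Hom.hom $hg)⟩
    · refine fun h ↦ subsingleton_of_forall_eq 0 fun e ↦ ?_
      obtain ⟨φ, hφ, rfl⟩ := P.extMk_surjective e (i + 2) rfl
      obtain ⟨ψ, hψ⟩ := h φ.hom congr(ModuleCat.Hom.hom $hφ)
      exact (P.extMk_eq_zero_iff φ (i + 2) rfl hφ i rfl).mpr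
        ⟨ModuleCat.ofHom ψ, ModuleCat.hom_ext hψ⟩
  rw [hTor, hExt, ← rTensor_exact_iff_lcomp_exact h0, LinearMap.rTensor_exact_iff_lTensor_exact]

end TorDual

/-! ### Depth as the length of a regular sequence. -/

section Depth

open RingTheory.Sequence

variable {R M : Type*} [CommRing R] [IsLocalRing R] [AddCommGroup M] [Module R M]

lemma localDepth_le [Nontrivial M] {n : ℕ∞} (h : ∀ rs : List R, (∀ x ∈ rs, x ∈ maximalIdeal R) →
    IsRegular M rs → (rs.length : ℕ∞) ≤ n) : localDepth R M ≤ n := by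
  rw [localDepth, if_neg (not_subsingleton M)]
  exact iSup_le fun rs ↦ h rs.1 rs.2.1 rs.2.2

lemma le_localDepth {rs : List R} (hmem : ∀ x ∈ rs, x ∈ maximalIdeal R) (hrs : IsRegular M rs) :
    (rs.length : ℕ∞) ≤ localDepth R M := by
  rw [localDepth, if_neg (not_subsingleton_iff_nontrivial.mpr hrs.nontrivial)]
  exact le_iSup (fun rs : {rs : List R // (∀ x ∈ rs, x ∈ maximalIdeal R) ∧ IsRegular M rs} ↦
    (rs.1.length : ℕ∞)) ⟨rs, hmem, hrs⟩

lemma exists_length_eq_localDepth [Nontrivial M] (h : localDepth R M < ⊤) :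
    ∃ rs : List R, (∀ x ∈ rs, x ∈ maximalIdeal R) ∧ IsRegular M rs ∧
      (rs.length : ℕ∞) = localDepth R M := by
  rw [localDepth, if_neg (not_subsingleton M)] at h ⊢
  have : Nonempty {rs : List R // (∀ x ∈ rs, x ∈ maximalIdeal R) ∧ IsRegular M rs} :=
    ⟨[], by simp, .nil R M⟩
  obtain ⟨rs, hrs⟩ := ENat.exists_eq_iSup_of_lt_top h
  exact ⟨rs.1, rs.2.1, rs.2.2, hrs⟩

/-- Regular sequences lift along a surjective ring homomorphism. -/
lemma exists_isWeaklyRegular_lift {S : Type*} [CommRing S] [IsLocalRing S] [Algebra S R]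
    [Module S M] [IsScalarTower S R M] (hsurj : Function.Surjective (algebraMap S R))
    (rs : List R) (hmem : ∀ x ∈ rs, x ∈ maximalIdeal R) (hrs : IsRegular M rs) :
    ∃ xs : List S, (∀ x ∈ xs, x ∈ maximalIdeal S) ∧ IsWeaklyRegular M xs ∧
      xs.length = rs.length := by
  obtain ⟨xs, rfl⟩ := List.map_surjective_iff.mpr hsurj rs
  have := hsurj.isLocalHom (algebraMap S R)
  refine ⟨xs, fun x hx ↦ ?_, (isWeaklyRegular_map_algebraMap_iff R M xs).mp hrs.1, by simp⟩
  exact ((mem_maximalIdeal _).trans (map_mem_nonunits_iff (algebraMap S R) x).symm).mpr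
    (hmem _ (List.mem_map_of_mem hx))

/-- The depth of a Noetherian local ring is the length of any maximal regular sequence. -/
lemma localDepth_self_eq {S : Type u} [CommRing S] [IsLocalRing S] [IsNoetherianRing S]
    {ys : List S} (hys : IsMaximalRegular S ys) : localDepth S S = ys.length := by
  refine le_antisymm (localDepth_le fun rs hmem hrs ↦ ?_) (le_localDepth hys.mem
    (IsRegular.of_isWeaklyRegular_of_mem_maximalIdeal S hys.mem hys.isWeaklyRegular))
  have hproj : Projective (ModuleCat.of S S) := (IsProjective.iff_projective S).mp inferInstance
  obtain ⟨p, -, hp⟩ := exists_hasProjectiveDimensionLE_add_length_le hys (M := S)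
    ⟨0, (projective_iff_hasProjectiveDimensionLE_zero _).mp hproj⟩
  exact_mod_cast le_of_add_le_left (hp rs hrs.1 hmem)

end Depth

/-! ### The depth equality and the main theorem. -/

open RingTheory.Sequence in
/-- The vanishing of `Tor^S(M, N)` in positive degrees, and the equality in the depth inequality. -/
lemma depth_add_eq_and_extVanishes {S R : Type u} [CommRing S] [IsLocalRing S] [IsNoetherianRing S]
    [CommRing R] [IsLocalRing R] [Algebra S R] (hsurj : Function.Surjective (algebraMap S R))
    (M N : Type u) [AddCommGroup M] [Module R M] [Module S M] [IsScalarTower S R M]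
    [AddCommGroup N] [Module R N] [Module S N] [IsScalarTower S R N]
    [Module.Finite R M] [Module.Finite R N] [Nontrivial M] [Nontrivial N]
    (hpd : ∃ n : ℕ, HasProjectiveDimensionLE (ModuleCat.of S M) n)
    (hlen : IsFiniteLength R (M ⊗[R] N))
    (hdepth : localDepth S S ≤ localDepth R M + localDepth R N) :
    localDepth R M + localDepth R N = localDepth S S ∧
      ∀ i, ExtVanishes S (i + 1) N (CharacterModule M) := by
  have : Module.Finite S R := .of_surjective (Algebra.linearMap S R) hsurj
  have : Module.Finite S M := .trans R M
  have : Module.Finite S N := .trans R N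
  obtain ⟨ys, hys⟩ := exists_isMaximalRegular S
  obtain ⟨p, hp, hMp⟩ := exists_hasProjectiveDimensionLE_add_length_le hys hpd
  have hpow (x : S) (hx : x ∈ maximalIdeal S) :
      ∃ k, x ^ k ∈ Module.annihilator S N ⊔ Module.annihilator S (CharacterModule M) := by
    have hloc := hsurj.isLocalHom (algebraMap S R)
    obtain ⟨n, hn⟩ := exists_pow_smul_eq_zero hlen
      (((mem_maximalIdeal _).trans (map_mem_nonunits_iff (algebraMap S R) x).symm).mp hx)
    obtain ⟨k, hk⟩ := exists_pow_mem_annihilator_sup hn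
    obtain ⟨a, ha, b, hb, hab⟩ := Submodule.mem_sup.mp hk
    obtain ⟨a, rfl⟩ := hsurj a
    rw [Module.mem_annihilator] at ha hb
    -- Only the summand killing `M` is lifted to `S`; the rest, `x ^ k - a`, maps to `b` and so
    -- kills `N`.
    refine ⟨k, Submodule.mem_sup.mpr ⟨x ^ k - a, ?_, a, ?_, sub_add_cancel _ _⟩⟩
    · refine Module.mem_annihilator.mpr fun y ↦ ?_
      rw [← algebraMap_smul R, map_sub, map_pow, ← hab, add_sub_cancel_left, hb]
    · refine Module.mem_annihilator.mpr fun c ↦ ?_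
      ext m
      rw [CharacterModule.smul_apply, ← algebraMap_smul R, ha, map_zero]
      rfl
  have hvan (zs : List S) (hmem : ∀ z ∈ zs, z ∈ maximalIdeal S) (hreg : IsWeaklyRegular N zs)
      (i : ℕ) (hi : p < i + zs.length) : ExtVanishes S i N (CharacterModule M) :=
    extVanishes_of_isWeaklyRegular (fun i hi W ↦ extVanishes_characterModule hp i hi W) zs hreg
      (fun z hz ↦ hpow z (hmem z hz)) i hi
  have hNp (zs : List S) (hmem : ∀ z ∈ zs, z ∈ maximalIdeal S) (hreg : IsWeaklyRegular N zs) :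
      zs.length ≤ p := by
    by_contra! hlt
    -- A longer sequence would give `Hom(N, M^∨) = 0`, that is `N ⊗ M = 0`.
    have h0 := hvan zs hmem hreg 0 (by lia)
    rw [extVanishes_zero_iff, subsingleton_linearMap_characterModule_iff] at h0
    exact not_subsingleton_iff_nontrivial.mpr nontrivial_tensorProduct_of_isLocalRing h0
  rw [localDepth_self_eq hys] at hdepth ⊢
  have hN : localDepth R N ≤ p := localDepth_le fun rs hmem hrs ↦ by
    obtain ⟨zs, hzmem, hzreg, hlen⟩ := exists_isWeaklyRegular_lift (S := S) hsurj rs hmem hrs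
    rw [← hlen]
    exact_mod_cast hNp zs hzmem hzreg
  have hM : localDepth R M ≤ ys.length := localDepth_le fun rs hmem hrs ↦ by
    obtain ⟨xs, hxmem, hxreg, hlen⟩ := exists_isWeaklyRegular_lift (S := S) hsurj rs hmem hrs
    rw [← hlen]
    exact_mod_cast le_of_add_le_left (hMp xs hxreg hxmem)
  obtain ⟨rs, hmem, hrs, hrlen⟩ :=
    exists_length_eq_localDepth (hM.trans_lt (ENat.natCast_lt_top _))
  obtain ⟨xs, hxmem, hxreg, hxlen⟩ := exists_isWeaklyRegular_lift (S := S) hsurj rs hmem hrs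
  obtain ⟨rs', hmem', hrs', hrlen'⟩ :=
    exists_length_eq_localDepth (hN.trans_lt (ENat.natCast_lt_top p))
  obtain ⟨zs, hzmem, hzreg, hzlen⟩ := exists_isWeaklyRegular_lift (S := S) hsurj rs' hmem' hrs'
  rw [← hrlen, ← hrlen', ← hxlen, ← hzlen] at hdepth ⊢
  -- From `xs.length + p ≤ ys.length ≤ xs.length + zs.length` and `zs.length ≤ p`, all are
  -- equalities; hence the vanishing starts at degree 1.
  have h1 := hMp xs hxreg hxmem
  have h2 := hNp zs hzmem hzreg
  norm_cast at hdepth ⊢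
  exact ⟨by lia, fun i ↦ hvan zs hzmem hzreg (i + 1) (by lia)⟩

theorem theorem4p6 {S R : Type u} [CommRing S] [IsLocalRing S] [IsNoetherianRing S]
    [CommRing R] [IsLocalRing R] [Algebra S R]
    (fs : List S) (hr : 1 ≤ fs.length) (hfs : RingTheory.Sequence.IsRegular S fs)
    -- `R = S/(f₁, …, f_r)`
    (hsurj : Function.Surjective (algebraMap S R))
    (hker : RingHom.ker (algebraMap S R) = Ideal.ofList fs)
    (M N : Type u)
    [AddCommGroup M] [Module R M] [Module S M] [IsScalarTower S R M]
    [AddCommGroup N] [Module R N]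
    [Module.Finite R M] [Module.Finite R N] [Nontrivial M] [Nontrivial N]
    -- `M` has finite projective dimension as an `S`-module
    (hpd : ∃ n : ℕ, CategoryTheory.HasProjectiveDimensionLE (ModuleCat.of S M) n)
    (hlen : IsFiniteLength R (TensorProduct R M N))
    (hdepth : localDepth S S ≤ localDepth R M + localDepth R N) :
    localDepth R M + localDepth R N = localDepth S S ∧
      ∀ i : ℕ, Nontrivial (torModule R i M N) ↔ Even i := by
  let : Module S N := Module.compHom N (algebraMap S R)
  have : IsScalarTower S R N := .of_algebraMap_smul fun _ _ ↦ rfl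
  have := characterModule_isScalarTower S R M
  obtain ⟨hd, hvan⟩ := depth_add_eq_and_extVanishes hsurj M N hpd hlen hdepth
  refine ⟨hd, fun i ↦ ?_⟩
  have hMN : Nontrivial (M ⊗[R] N) := nontrivial_tensorProduct_of_isLocalRing
  obtain _ | i := i
  · simpa [nontrivial_torModule_zero_iff] using hMN
  · have hhom : Nontrivial (N →ₗ[R] CharacterModule M) := by
      rw [← not_subsingleton_iff_nontrivial, subsingleton_linearMap_characterModule_iff,
        not_subsingleton_iff_nontrivial]
      exact (TensorProduct.comm R N M).toEquiv.nontrivial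
    rw [← not_subsingleton_iff_nontrivial, subsingleton_torModule_succ_iff,
      extVanishes_iff_odd_of_isWeaklyRegular hsurj fs (List.ne_nil_of_length_pos hr) hfs.1 hker
        (fun i ↦ hvan (2 * i)), not_not]
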